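/- Let $(\Omega,\mathcal F,\mathcal Q)$ be a probability space, let $A$ be a real orthogonal $2\times 2$ matrix with transpose $A'$, and for $X\in\{F,V\}$ and $l=1,2$ let $\lambda_{X,l},a_{X,l},b_{X,l}>0$ and $X^{(l)}_0\in\mathbb R$ be constants. Let $Z^{F,1},Z^{F,2},Z^{V,1},Z^{V,2}$ be independent inverse Gaussian subordinators, that is, Lévy processes with nondecreasing paths and $$E_{\mathcal Q}\big[e^{iuZ^{X,l}_t}\big]=\exp\Big(-t\,a_{X,l}\big(\sqrt{-2iu+b_{X,l}^2}-b_{X,l}\big)\Big),\qquad t\ge 0,\ u\in\mathbb R .$$ Let $F^{(l)}$ and $V^{(l)}$ be the Ornstein–Uhlenbeck processes with deterministic initial values $F^{(l)}_0$, $V^{(l)}_0$ that solve $$dF^{(l)}_t=-\lambda_{F,l}F^{(l)}_t\,dt+dZ^{F,l}_{\lambda_{F,l}t},\qquad dV^{(l)}_t=-\lambda_{V,l}V^{(l)}_t\,dt+dZ^{V,l}_{\lambda_{V,l}t},$$ and put $$\Sigma_t=\mathrm{diag}(F_t)+A\,\mathrm{diag}(V_t)\,A',\qquad \Sigma^+_t=\int_0^t\Sigma_s\,ds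 .$$ Let $C_l$ be the $2\times2$ matrix with a one in position $(l,l)$ and zeros elsewhere. Then for every $t\ge 0$ and every real $2\times 2$ matrix $\theta=(\theta_{kj})$ (in particular for every $\theta\neq 0$), the characteristic function $\varphi_{\Sigma_t^+}(\theta)=E_{\mathcal Q}[\exp(i\,\mathrm{tr}(\theta\Sigma^+_t))]$ is $$\varphi_{\Sigma_t^+}(\theta)=\exp\big(K_1^+(\theta)+K_2^+(\theta)\big),$$ where $$K_1^+(\theta)=i\sum_{l=1}^2\theta_{ll}\,\lambda_{F,l}^{-1}(1-e^{-\lambda_{F,l}t})F_0^{(l)}+\sum_{l=1}^2 I_F^{(l)}(\lambda_{F,l}t,\theta_{ll}),$$ $$K_2^+(\theta)=i\sum_{l=1}^2\mathrm{tr}(\theta AC_lA')\,\lambda_{V,l}^{-1}(1-e^{-\lambda_{V,l}t})V_0^{(l)}+\sum_{l=1}^2 I_V^{(l)}\big(\lambda_{V,l}t,\mathrm{tr}(\theta AC_lA')\big).$$ Here, for $X\in\{F,V\}$ and real $\tilde\theta\neq 0$, $$I_X^{(l)}(\lambda_{X,l}t,\tilde\theta)=-\frac{2a_{X,l}}{\sqrt{i\lambda_{X,l}}}\Big[-T_2^{X,l}(t,\tilde\theta)+\sqrt{i\lambda_{X,l}}\,b_{X,l}+\frac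 i2\,T_1^{X,l}(\tilde\theta)\,G^{X,l}(\tilde\theta)\Big]+\lambda_{X,l}a_{X,l}b_{X,l}t,$$ while $I_X^{(l)}(\lambda_{X,l}t,0)=0$ (the limit as $\tilde\theta\to0$), and $$T_1^{X,l}(\tilde\theta)=\sqrt{-2\tilde\theta-i\lambda_{X,l}b_{X,l}^2},\qquad T_2^{X,l}(t,\tilde\theta)=\sqrt{2\tilde\theta(1-e^{-\lambda_{X,l}t})+i\lambda_{X,l}b_{X,l}^2},$$ $$G^{X,l}(\tilde\theta)=\log\left(e^{-\lambda_{X,l}t}\,\frac{\big(T_1^{X,l}(\tilde\theta)+i\sqrt{i\lambda_{X,l}}\,b_{X,l}\big)^2}{\big(T_1^{X,l}(\tilde\theta)+i\,T_2^{X,l}(t,\tilde\theta)\big)^2}\right),$$ with principal branches of all square roots and of the logarithm. -/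

import Mathlib

open MeasureTheory ProbabilityTheory
open scoped NNReal Topology

namespace OUCovariance

noncomputable section

/-- Real-valued Lévy process on `[0, ∞)`. Stochastic continuity follows from the right-continuity
of the paths and the stationarity of the increments. -/
structure IsLevyProcess {Ω : Type*} [MeasurableSpace Ω] (P : Measure Ω)
    (Z : ℝ≥0 → Ω → ℝ) : Prop where
  measurable : ∀ t, Measurable (Z t)
  start_zero : ∀ᵐ ω ∂P, Z 0 ω = 0
  indep_increments : HasIndepIncrements Z P
  stationary_increments : ∀ s t : ℝ≥0, IdentDistrib (fun ω => Z (s + t) ω - Z s ω) (Z t) P P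
  cadlag : ∀ᵐ ω ∂P, ∀ t : ℝ≥0,
    ContinuousWithinAt (fun s => Z s ω) (Set.Ici t) t ∧
      ∃ l : ℝ, Filter.Tendsto (fun s => Z s ω) (𝓝[<] t) (𝓝 l)

/-- `Ψ` is the characteristic exponent of `Z`: `E[exp(i u Z_t)] = exp(t Ψ(u))`. -/
def HasCharExponent {Ω : Type*} [MeasurableSpace Ω] (P : Measure Ω)
    (Z : ℝ≥0 → Ω → ℝ) (Ψ : ℝ → ℂ) : Prop :=
  ∀ (t : ℝ≥0) (u : ℝ), charFun (P.map (Z t)) u = Complex.exp ((t : ℂ) * Ψ u)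

/-- The inverse Gaussian exponent `-a (√(-2 i u + b²) - b)`, with the principal square root. -/
def igExponent (a b u : ℝ) : ℂ :=
  -(a : ℂ) * (Complex.sqrt (-2 * Complex.I * (u : ℂ) + (b : ℂ) ^ 2) - (b : ℂ))

/-- Inverse Gaussian subordinator with parameters `a` and `b`. -/
structure IsIGSubordinator {Ω : Type*} [MeasurableSpace Ω] (P : Measure Ω) (a b : ℝ)
    (Z : ℝ≥0 → Ω → ℝ) : Prop extends IsLevyProcess P Z where
  monotone_paths : ∀ᵐ ω ∂P, Monotone (fun t => Z t ω)
  charExponent : HasCharExponent P Z (igExponent a b)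

/-- `X` solves `dX_t = -lam X_t dt + dZ_{lam t}` with the deterministic initial value `x₀`:
almost surely the path of `X` is integrable on bounded intervals and the integrated form of the
equation holds at all times. -/
def IsOUProcess {Ω : Type*} [MeasurableSpace Ω] (P : Measure Ω) (lam x₀ : ℝ)
    (Z X : ℝ≥0 → Ω → ℝ) : Prop :=
  ∀ᵐ ω ∂P, ∀ t : ℝ≥0,
    IntervalIntegrable (fun s : ℝ => X s.toNNReal ω) volume 0 (t : ℝ) ∧
      X t ω = x₀ - lam * (∫ s in (0 : ℝ)..(t : ℝ), X s.toNNReal ω) + Z (lam * (t : ℝ)).toNNReal ω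

/-- `Σ_t = diag(F_t) + A diag(V_t) A'`. -/
def covariance {Ω : Type*} (A : Matrix (Fin 2) (Fin 2) ℝ) (F V : Fin 2 → ℝ≥0 → Ω → ℝ)
    (t : ℝ≥0) (ω : Ω) : Matrix (Fin 2) (Fin 2) ℝ :=
  Matrix.diagonal (fun l => F l t ω) + A * Matrix.diagonal (fun l => V l t ω) * A.transpose

/-- `Σ_t⁺ = ∫_0^t Σ_s ds`, entry by entry. -/
def integratedCovariance {Ω : Type*} (A : Matrix (Fin 2) (Fin 2) ℝ) (F V : Fin 2 → ℝ≥0 → Ω → ℝ)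
    (t : ℝ≥0) (ω : Ω) : Matrix (Fin 2) (Fin 2) ℝ :=
  Matrix.of fun j k => ∫ s in (0 : ℝ)..(t : ℝ), covariance A F V s.toNNReal ω j k

/-- Characteristic function of a random matrix, `E[exp(i tr(θ X))]`. -/
def matrixCharFun {Ω : Type*} [MeasurableSpace Ω] (P : Measure Ω)
    (X : Ω → Matrix (Fin 2) (Fin 2) ℝ) (θ : Matrix (Fin 2) (Fin 2) ℝ) : ℂ :=
  ∫ ω, Complex.exp (Complex.I * ((Matrix.trace (θ * X ω) : ℝ) : ℂ)) ∂P

/-- `√(i lam)`. -/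
def sqrtILam (lam : ℝ) : ℂ := Complex.sqrt (Complex.I * (lam : ℂ))

/-- `T₁(x) = √(-2x - i lam b²)`. -/
def T₁ (lam b x : ℝ) : ℂ :=
  Complex.sqrt (-2 * (x : ℂ) - Complex.I * (lam : ℂ) * (b : ℂ) ^ 2)

/-- `T₂(t, x) = √(2x (1 - exp(-lam t)) + i lam b²)`. -/
def T₂ (lam b t x : ℝ) : ℂ :=
  Complex.sqrt (2 * (x : ℂ) * (1 - Complex.exp (-(lam : ℂ) * (t : ℂ))) +
    Complex.I * (lam : ℂ) * (b : ℂ) ^ 2)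

/-- `G(x) = log(exp(-lam t) (T₁ + i √(i lam) b)² / (T₁ + i T₂)²)`, principal logarithm. -/
def G (lam b t x : ℝ) : ℂ :=
  Complex.log (Complex.exp (-(lam : ℂ) * (t : ℂ)) *
    ((T₁ lam b x + Complex.I * sqrtILam lam * (b : ℂ)) ^ 2 /
      (T₁ lam b x + Complex.I * T₂ lam b t x) ^ 2))

/-- The term `I(lam t, x)`: the closed form for `x ≠ 0`, and its limit `0` at `x = 0`, where the
argument of the logarithm in `G` is `0 / 0`. -/
def intExponent (lam a b t x : ℝ) : ℂ :=
  if x = 0 then 0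
  else -(2 * (a : ℂ) / sqrtILam lam) *
      (-T₂ lam b t x + sqrtILam lam * (b : ℂ) +
        Complex.I / 2 * T₁ lam b x * G lam b t x) +
    (lam : ℂ) * (a : ℂ) * (b : ℂ) * (t : ℂ)

/-- `tr(θ A C_l A')`, where `C_l` has a one in position `(l, l)` and zeros elsewhere. -/
def loading (A θ : Matrix (Fin 2) (Fin 2) ℝ) (l : Fin 2) : ℝ :=
  Matrix.trace (θ * A * Matrix.single l l (1 : ℝ) * A.transpose)

/-- Contribution of the idiosyncratic factors to the exponent. -/
def K₁ (lam a b F₀ : Fin 2 → ℝ) (t : ℝ) (θ : Matrix (Fin 2) (Fin 2) ℝ) : ℂ :=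
  Complex.I * ∑ l, (θ l l : ℂ) * (lam l : ℂ)⁻¹ *
      (1 - Complex.exp (-(lam l : ℂ) * (t : ℂ))) * (F₀ l : ℂ) +
    ∑ l, intExponent (lam l) (a l) (b l) t (θ l l)

/-- Contribution of the common factors to the exponent. -/
def K₂ (A : Matrix (Fin 2) (Fin 2) ℝ) (lam a b V₀ : Fin 2 → ℝ) (t : ℝ)
    (θ : Matrix (Fin 2) (Fin 2) ℝ) : ℂ :=
  Complex.I * ∑ l, (loading A θ l : ℂ) * (lam l : ℂ)⁻¹ *
      (1 - Complex.exp (-(lam l : ℂ) * (t : ℂ))) * (V₀ l : ℂ) +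
    ∑ l, intExponent (lam l) (a l) (b l) t (loading A θ l)

end

end OUCovariance

/-! The trace `tr(θ Σ⁺)` is a linear combination of four independent integrated Ornstein–Uhlenbeck
processes, so the claim reduces to one such process. Variation of constants and integration by parts
turn its path into a deterministic term plus `∫ (1 - exp(-lam (t - s))) / lam dZ(lam s)`, which is a
pathwise limit of left-endpoint sums (`IsOUProcess.tendsto_ouSum`). By independence and stationarity
of increments, the characteristic function of such a sum is the exponential of a Riemann sum of the
Lévy exponent; dominated convergence gives the exponential of its integral
(`integral_exp_sum_integrated_ou`).

The integral is evaluated by differentiating the closed form (`hasDerivAt_intExponent`). The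
delicate point is the branch of the logarithm: `G_eq_log` rewrites its argument as a positive
multiple of a quotient of two points of the upper half plane, which never meets the cut. -/

namespace OUCovariance

/-! ### Principal square roots and the slit plane. -/

section ComplexSqrt

lemma csqrt_sq (z : ℂ) : Complex.sqrt z ^ 2 = z := by
  simp [Complex.sqrt]

lemma csqrt_eq_of_sq_eq {w z : ℂ} (hw : 0 < w.re) (h : w ^ 2 = z) : Complex.sqrt z = w := by
  subst h
  exact Complex.sq_cpow_two_inv hw

lemma csqrt_re_nonneg (z : ℂ) : 0 ≤ (Complex.sqrt z).re := by
  simp only [Complex.sqrt, Complex.cpow_inv_two_re]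
  positivity

lemma csqrt_re_pos {z : ℂ} (hz : z ∈ Complex.slitPlane) : 0 < (Complex.sqrt z).re := by
  refine (csqrt_re_nonneg z).lt_of_ne fun h => ?_
  have h2 := csqrt_sq z
  have hre := congrArg Complex.re h2
  have him := congrArg Complex.im h2
  simp only [sq, Complex.mul_re, Complex.mul_im, ← h] at hre him
  rcases hz with hz | hz
  · nlinarith [mul_self_nonneg (Complex.sqrt z).im]
  · apply hz
    linarith

lemma csqrt_im_mul_re (z : ℂ) : 2 * ((Complex.sqrt z).re * (Complex.sqrt z).im) = z.im := by
  have him := congrArg Complex.im (csqrt_sq z)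
  simp only [sq, Complex.mul_im] at him
  linarith

lemma csqrt_im_pos {z : ℂ} (hz : 0 < z.im) : 0 < (Complex.sqrt z).im := by
  have h1 := csqrt_re_nonneg z
  have h2 := csqrt_im_mul_re z
  by_contra! h
  nlinarith

lemma csqrt_im_neg {z : ℂ} (hz : z.im < 0) : (Complex.sqrt z).im < 0 := by
  have h1 := csqrt_re_nonneg z
  have h2 := csqrt_im_mul_re z
  by_contra! h
  nlinarith

lemma hasDerivAt_csqrt_comp {f : ℝ → ℂ} {f' : ℂ} {u : ℝ} (hf : HasDerivAt f f' u)
    (hz : f u ∈ Complex.slitPlane) :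
    HasDerivAt (fun v => Complex.sqrt (f v)) (f' / (2 * Complex.sqrt (f u))) u := by
  have h := (Complex.hasDerivAt_sqrt hz).comp u hf
  refine h.congr_deriv ?_
  rw [show (-1 / 2 : ℂ) = -(2⁻¹) by norm_num, Complex.cpow_neg]
  simp only [Complex.sqrt]
  ring

/-- If `p / q` were a real `r ≤ 0`, then `p = r q` would have nonpositive imaginary part. -/
lemma div_mem_slitPlane_of_im_pos {p q : ℂ} (hp : 0 < p.im) (hq : 0 < q.im) :
    p / q ∈ Complex.slitPlane := by
  have hq0 : q ≠ 0 := by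
    rintro rfl
    simp at hq
  rw [Complex.mem_slitPlane_iff]
  by_contra! h
  have h1 : p = (p / q) * q := by field_simp
  have h2 := congrArg Complex.im h1
  rw [Complex.mul_im, h.2] at h2
  nlinarith [h.1]

end ComplexSqrt

/-! ### The closed form as the integral of the inverse Gaussian exponent. -/

section IntegratedExponent

variable {lam a b t x u : ℝ}

lemma T₂_radicand_im (lam b t x : ℝ) :
    (2 * (x : ℂ) * (1 - Complex.exp (-(lam : ℂ) * (t : ℂ))) +
      Complex.I * (lam : ℂ) * (b : ℂ) ^ 2).im = lam * b ^ 2 := by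
  rw [show (2 * (x : ℂ) * (1 - Complex.exp (-(lam : ℂ) * (t : ℂ))) +
      Complex.I * (lam : ℂ) * (b : ℂ) ^ 2) =
      ((2 * x * (1 - Real.exp (-lam * t)) : ℝ) : ℂ) + ((lam * b ^ 2 : ℝ) : ℂ) * Complex.I by
    push_cast; ring]
  simp [-Complex.ofReal_mul, -Complex.ofReal_pow]

lemma T₂_re_pos (hlam : 0 < lam) (hb : 0 < b) : 0 < (T₂ lam b t x).re :=
  csqrt_re_pos (Or.inr (by rw [T₂_radicand_im]; positivity))

lemma T₂_im_pos (hlam : 0 < lam) (hb : 0 < b) : 0 < (T₂ lam b t x).im :=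
  csqrt_im_pos (by rw [T₂_radicand_im]; positivity)

lemma T₂_ne_zero (hlam : 0 < lam) (hb : 0 < b) : T₂ lam b t x ≠ 0 := fun h => by
  have := T₂_re_pos (t := t) (x := x) hlam hb
  simp [h] at this

lemma T₂_sq (lam b t x : ℝ) : T₂ lam b t x ^ 2 =
    2 * (x : ℂ) * (1 - Complex.exp (-(lam : ℂ) * (t : ℂ))) +
      Complex.I * (lam : ℂ) * (b : ℂ) ^ 2 := csqrt_sq _

lemma T₁_sq (lam b x : ℝ) : T₁ lam b x ^ 2 =
    -2 * (x : ℂ) - Complex.I * (lam : ℂ) * (b : ℂ) ^ 2 := csqrt_sq _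

lemma T₁_radicand_im (lam b x : ℝ) :
    (-2 * (x : ℂ) - Complex.I * (lam : ℂ) * (b : ℂ) ^ 2).im = -(lam * b ^ 2) := by
  rw [show (-2 * (x : ℂ) - Complex.I * (lam : ℂ) * (b : ℂ) ^ 2) =
      ((-2 * x : ℝ) : ℂ) + ((-(lam * b ^ 2) : ℝ) : ℂ) * Complex.I by push_cast; ring]
  simp [-Complex.ofReal_mul, -Complex.ofReal_pow, -Complex.ofReal_neg]

lemma T₁_re_pos (hlam : 0 < lam) (hb : 0 < b) : 0 < (T₁ lam b x).re :=
  csqrt_re_pos (Or.inr (by rw [T₁_radicand_im]; apply ne_of_lt; rw [neg_lt_zero]; positivity))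

lemma T₁_im_neg (hlam : 0 < lam) (hb : 0 < b) : (T₁ lam b x).im < 0 :=
  csqrt_im_neg (by rw [T₁_radicand_im, neg_lt_zero]; positivity)

lemma sqrtILam_sq (lam : ℝ) : sqrtILam lam ^ 2 = Complex.I * (lam : ℂ) := csqrt_sq _

lemma sqrtILam_re_pos (hlam : 0 < lam) : 0 < (sqrtILam lam).re :=
  csqrt_re_pos (Or.inr (by simp [hlam.ne']))

lemma sqrtILam_im_pos (hlam : 0 < lam) : 0 < (sqrtILam lam).im :=
  csqrt_im_pos (by simp [hlam])

lemma sqrtILam_ne_zero (hlam : 0 < lam) : sqrtILam lam ≠ 0 := fun h => by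
  have := sqrtILam_re_pos hlam
  simp [h] at this

lemma T₂_zero (hlam : 0 < lam) (hb : 0 < b) : T₂ lam b 0 x = sqrtILam lam * (b : ℂ) := by
  apply csqrt_eq_of_sq_eq
  · simpa using mul_pos (sqrtILam_re_pos hlam) hb
  · rw [mul_pow, sqrtILam_sq]
    simp

/-- The two square roots `√(b² - 2 i x (1 - exp(-lam t)) / lam)` and `√(i lam)` multiply to `T₂`
without leaving the principal branch. -/
lemma T₂_eq_mul_csqrt (hlam : 0 < lam) (hb : 0 < b) :
    T₂ lam b t x = sqrtILam lam * Complex.sqrt (-2 * Complex.I *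
      ((x * ((1 - Real.exp (-lam * t)) / lam) : ℝ) : ℂ) + (b : ℂ) ^ 2) := by
  set r : ℝ := x * ((1 - Real.exp (-lam * t)) / lam) with hr
  set z : ℂ := -2 * Complex.I * (r : ℂ) + (b : ℂ) ^ 2 with hz
  have hzre : z.re = b ^ 2 := by simp [hz, ← Complex.ofReal_pow]
  have hzs : z ∈ Complex.slitPlane := Or.inl (by rw [hzre]; positivity)
  have h1 := csqrt_re_pos hzs
  have h2 := congrArg Complex.re (csqrt_sq z)
  have h3 := congrArg Complex.re (sqrtILam_sq lam)
  simp only [sq, Complex.mul_re, hzre] at h2 h3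
  have h4 := sqrtILam_re_pos hlam
  have h5 := sqrtILam_im_pos hlam
  simp only [Complex.I_re, Complex.I_im, Complex.ofReal_im] at h3
  -- `√(i lam)` lies on the diagonal: its square has real part zero and both parts are positive.
  have h6 : (sqrtILam lam).re = (sqrtILam lam).im := by nlinarith
  apply csqrt_eq_of_sq_eq
  -- With `w = √z`, the sign is that of `w.re - w.im`, positive because `w.re² - w.im² = b² > 0` and
  -- `w.re > 0`.
  · rw [Complex.mul_re, ← h6, ← mul_sub]
    apply mul_pos h4
    nlinarith [pow_pos hb 2]
  · rw [mul_pow, sqrtILam_sq, csqrt_sq, hz, hr]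
    have : (lam : ℂ) ≠ 0 := by exact_mod_cast hlam.ne'
    push_cast
    field_simp
    linear_combination (-2 * (x : ℂ) * (1 - Complex.exp (-(lam * t : ℂ)))) * Complex.I_sq

lemma hasDerivAt_T₂ (hlam : 0 < lam) (hb : 0 < b) :
    HasDerivAt (fun v : ℝ => T₂ lam b v x)
      (lam * x * Complex.exp (-(lam : ℂ) * (u : ℂ)) / T₂ lam b u x) u := by
  have h0 : HasDerivAt (fun v : ℝ => -(lam : ℂ) * (v : ℂ)) (-(lam : ℂ)) u := by
    simpa using (Complex.ofRealCLM.hasDerivAt (x := u)).const_mul (-(lam : ℂ))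
  have h1 : HasDerivAt (fun v : ℝ => 2 * (x : ℂ) * (1 - Complex.exp (-(lam : ℂ) * (v : ℂ))) +
      Complex.I * (lam : ℂ) * (b : ℂ) ^ 2)
      (2 * (x : ℂ) * (-(Complex.exp (-(lam : ℂ) * (u : ℂ)) * -(lam : ℂ)))) u :=
    ((h0.cexp.const_sub 1).const_mul _).add_const _
  refine (hasDerivAt_csqrt_comp h1 (Or.inr ?_)).congr_deriv ?_
  · rw [T₂_radicand_im]
    positivity
  · rw [← T₂]
    have := T₂_ne_zero (t := u) (x := x) hlam hb
    field_simp

lemma sq_im_pos {z : ℂ} (h1 : 0 < z.re) (h2 : 0 < z.im) : 0 < (z ^ 2).im := by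
  simp only [sq, Complex.mul_im]
  positivity

/-- `T₁` lies in the open fourth quadrant, so `i T₁` joins `T₂` in the first. The square of the sum
is then in the upper half plane. -/
lemma T₂_add_re_im_pos (hlam : 0 < lam) (hb : 0 < b) :
    0 < (T₂ lam b t x + Complex.I * T₁ lam b x).re ∧
      0 < (T₂ lam b t x + Complex.I * T₁ lam b x).im := by
  have h1 := T₂_re_pos (t := t) (x := x) hlam hb
  have h2 := T₂_im_pos (t := t) (x := x) hlam hb
  have h3 := T₁_re_pos (x := x) hlam hb
  have h4 := T₁_im_neg (x := x) hlam hb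
  constructor
  · simp
    linarith
  · simp
    linarith

lemma T₂_add_ne_zero (hlam : 0 < lam) (hb : 0 < b) :
    T₂ lam b t x + Complex.I * T₁ lam b x ≠ 0 := fun h => by
  have := (T₂_add_re_im_pos (t := t) (x := x) hlam hb).1
  simp [h] at this

/-- The product is `T₂² + T₁²`, where the terms in `b²` cancel. This identity drives all the
simplifications below. -/
lemma T₂_sub_mul_add (lam b t x : ℝ) :
    (T₂ lam b t x - Complex.I * T₁ lam b x) * (T₂ lam b t x + Complex.I * T₁ lam b x) =
      -2 * x * Complex.exp (-(lam : ℂ) * (t : ℂ)) := by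
  linear_combination T₂_sq lam b t x + T₁_sq lam b x - T₁ lam b x ^ 2 * Complex.I_sq

/-- The logarithm `G` as the logarithm of a positive multiple of a quotient of two points of the
upper half plane. -/
lemma G_eq_log (hlam : 0 < lam) (hb : 0 < b) (hx : x ≠ 0) :
    G lam b t x = Complex.log (Complex.exp ((lam : ℂ) * (t : ℂ)) *
      ((T₂ lam b t x + Complex.I * T₁ lam b x) ^ 2 /
        (T₂ lam b 0 x + Complex.I * T₁ lam b x) ^ 2)) := by
  have hxc : (x : ℂ) ≠ 0 := by exact_mod_cast hx
  have hp := T₂_add_ne_zero (t := t) (x := x) hlam hb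
  have hp0 := T₂_add_ne_zero (t := 0) (x := x) hlam hb
  have hm := T₂_sub_mul_add lam b t x
  have hm0 := T₂_sub_mul_add lam b 0 x
  have hI := Complex.I_sq
  have he := Complex.exp_ne_zero (-(lam : ℂ) * (t : ℂ))
  -- `T₁ + i T₂ = i (T₂ - i T₁)`, and `T₂_sub_mul_add` trades the conjugate factor for a reciprocal.
  -- This swaps numerator and denominator in `G`; cancelling `(-2x)²` needs `x ≠ 0`.
  have e1 : T₁ lam b x + Complex.I * T₂ lam b t x =
      Complex.I * (-2 * x * Complex.exp (-(lam : ℂ) * (t : ℂ)) /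
        (T₂ lam b t x + Complex.I * T₁ lam b x)) := by
    rw [← hm, mul_div_cancel_right₀ _ hp]
    linear_combination (T₁ lam b x) * hI
  have e0 : T₁ lam b x + Complex.I * sqrtILam lam * (b : ℂ) =
      Complex.I * (-2 * x / (T₂ lam b 0 x + Complex.I * T₁ lam b x)) := by
    have : (-2 * x : ℂ) = (T₂ lam b 0 x - Complex.I * T₁ lam b x) *
      (T₂ lam b 0 x + Complex.I * T₁ lam b x) := by rw [hm0]; simp
    rw [this, mul_div_cancel_right₀ _ hp0, mul_assoc Complex.I, ← T₂_zero (x := x) hlam hb]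
    linear_combination (T₁ lam b x) * hI
  rw [G, e1, e0, show (lam : ℂ) * (t : ℂ) = -(-(lam : ℂ) * (t : ℂ)) by ring, Complex.exp_neg]
  congr 1
  have hI0 := Complex.I_ne_zero
  field_simp

/-- The logarithmic derivative is `lam + 2 T₂' / (T₂ + i T₁)`. By `T₂_sub_mul_add` the second term
is `-lam (T₂ - i T₁) / T₂`. -/
lemma hasDerivAt_G (hlam : 0 < lam) (hb : 0 < b) (hx : x ≠ 0) :
    HasDerivAt (fun v : ℝ => G lam b v x)
      (Complex.I * lam * T₁ lam b x / T₂ lam b u x) u := by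
  have hfun : (fun v : ℝ => G lam b v x) = fun v : ℝ =>
      Complex.log (Complex.exp ((lam : ℂ) * (v : ℂ)) *
      ((T₂ lam b v x + Complex.I * T₁ lam b x) ^ 2 /
        (T₂ lam b 0 x + Complex.I * T₁ lam b x) ^ 2)) := funext fun v => G_eq_log hlam hb hx
  rw [hfun]
  have h0 : HasDerivAt (fun v : ℝ => (lam : ℂ) * (v : ℂ)) (lam : ℂ) u := by
    simpa using (Complex.ofRealCLM.hasDerivAt (x := u)).const_mul (lam : ℂ)
  have hw := (((hasDerivAt_T₂ (x := x) (u := u) hlam hb).add_const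
    (Complex.I * T₁ lam b x)).pow 2).div_const ((T₂ lam b 0 x + Complex.I * T₁ lam b x) ^ 2)
  have hp := T₂_add_re_im_pos (t := u) (x := x) hlam hb
  have hp0 := T₂_add_re_im_pos (t := 0) (x := x) hlam hb
  have hs : Complex.exp ((lam : ℂ) * (u : ℂ)) *
      ((T₂ lam b u x + Complex.I * T₁ lam b x) ^ 2 /
        (T₂ lam b 0 x + Complex.I * T₁ lam b x) ^ 2) ∈ Complex.slitPlane := by
    rw [← mul_div_assoc]
    apply div_mem_slitPlane_of_im_pos _ (sq_im_pos hp0.1 hp0.2)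
    rw [← Complex.ofReal_mul, ← Complex.ofReal_exp, Complex.im_ofReal_mul]
    exact mul_pos (Real.exp_pos _) (sq_im_pos hp.1 hp.2)
  refine ((h0.cexp.mul hw).clog_real hs).congr_deriv ?_
  have hpn := T₂_add_ne_zero (t := u) (x := x) hlam hb
  have hpn0 := T₂_add_ne_zero (t := 0) (x := x) hlam hb
  have hwn := T₂_ne_zero (t := u) (x := x) hlam hb
  have hm := T₂_sub_mul_add lam b u x
  have hI := Complex.I_sq
  have he := Complex.exp_ne_zero ((lam : ℂ) * (u : ℂ))
  simp only [Pi.mul_apply, Pi.pow_apply]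
  field_simp
  push_cast
  simp only [neg_mul] at hm ⊢
  linear_combination (lam : ℂ) * (T₂ lam b u x + Complex.I * T₁ lam b x) * hm

/-- For `x ≠ 0` the bracket has derivative `-lam (2 x exp(-lam u) + T₁²) / (2 T₂) = lam T₂ / 2`, and
`T₂ / √(i lam)` is the square root in `igExponent`. -/
lemma hasDerivAt_intExponent (hlam : 0 < lam) (hb : 0 < b) :
    HasDerivAt (fun v : ℝ => intExponent lam a b v x)
      (lam * igExponent a b (x * ((1 - Real.exp (-lam * u)) / lam))) u := by
  rcases eq_or_ne x 0 with rfl | hx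
  · have : Complex.sqrt ((b : ℂ) ^ 2) = b := csqrt_eq_of_sq_eq (by simpa using hb) rfl
    simpa [intExponent, igExponent, this] using hasDerivAt_const u (0 : ℂ)
  · simp only [intExponent, if_neg hx]
    have h0 : HasDerivAt (fun v : ℝ => (lam : ℂ) * a * b * (v : ℂ)) ((lam : ℂ) * a * b) u := by
      simpa using (Complex.ofRealCLM.hasDerivAt (x := u)).const_mul ((lam : ℂ) * a * b)
    have h1 := ((((hasDerivAt_T₂ (x := x) (u := u) hlam hb).neg.add_const
      (sqrtILam lam * (b : ℂ))).add ((hasDerivAt_G (u := u) hlam hb hx).const_mul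
        (Complex.I / 2 * T₁ lam b x))).const_mul (-(2 * (a : ℂ) / sqrtILam lam))).add h0
    refine h1.congr_deriv ?_
    have hs := sqrtILam_ne_zero hlam
    have e : igExponent a b (x * ((1 - Real.exp (-lam * u)) / lam)) =
        -(a : ℂ) * (T₂ lam b u x / sqrtILam lam - b) := by
      rw [igExponent, T₂_eq_mul_csqrt hlam hb, mul_div_cancel_left₀ _ hs]
    rw [e]
    have hwn := T₂_ne_zero (t := u) (x := x) hlam hb
    have hm := T₂_sub_mul_add lam b u x
    have hI := Complex.I_sq
    simp only [neg_mul] at hm ⊢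
    field_simp
    linear_combination (a : ℂ) * (lam : ℂ) * hm

lemma intExponent_zero (hlam : 0 < lam) (hb : 0 < b) : intExponent lam a b 0 x = 0 := by
  rcases eq_or_ne x 0 with rfl | hx
  · simp [intExponent]
  · have hpn0 := T₂_add_ne_zero (t := 0) (x := x) hlam hb
    have hG : G lam b 0 x = 0 := by
      rw [G_eq_log hlam hb hx, div_self (pow_ne_zero 2 hpn0)]
      simp
    simp [intExponent, hG, T₂_zero hlam hb]

lemma continuous_igExponent_comp (hb : 0 < b) {g : ℝ → ℝ} (hg : Continuous g) :
    Continuous fun u => igExponent a b (g u) := by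
  unfold igExponent
  refine continuous_const.mul (Continuous.sub ?_ continuous_const)
  refine Complex.continuousOn_sqrt.comp_continuous (by fun_prop) fun u => Or.inl ?_
  have : (-2 * Complex.I * (g u : ℂ) + (b : ℂ) ^ 2).re = b ^ 2 := by simp [← Complex.ofReal_pow]
  rw [this]
  positivity

lemma integral_igExponent (hlam : 0 < lam) (hb : 0 < b) :
    ∫ u in (0 : ℝ)..t, lam * igExponent a b (x * ((1 - Real.exp (-lam * u)) / lam)) =
      intExponent lam a b t x := by
  rw [intervalIntegral.integral_eq_sub_of_hasDerivAt
    (fun u _ => hasDerivAt_intExponent hlam hb), intExponent_zero hlam hb, sub_zero]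
  apply Continuous.intervalIntegrable
  exact continuous_const.mul (continuous_igExponent_comp hb (by fun_prop))

end IntegratedExponent


/-! ### Pathwise analysis: the Ornstein–Uhlenbeck equation and limits of sums. -/

section Path

/-- Variation of constants for the integrated path of an Ornstein–Uhlenbeck equation driven by a
right-continuous monotone function. -/
lemma integral_eq_of_ou_equation {lam x₀ t : ℝ} (hlam : 0 < lam) (ht : 0 ≤ t) {X z : ℝ → ℝ}
    (hz : Monotone z) (hzc : ∀ s, 0 ≤ s → ContinuousWithinAt z (Set.Ici s) s)
    (hXi : IntervalIntegrable X volume 0 t)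
    (hX : ∀ s, 0 ≤ s → X s = x₀ - lam * (∫ r in (0 : ℝ)..s, X r) + z s) :
    ∫ s in (0 : ℝ)..t, X s = x₀ * ((1 - Real.exp (-lam * t)) / lam) +
      ∫ s in (0 : ℝ)..t, Real.exp (-lam * (t - s)) * z s := by
  have hYc : ContinuousOn (fun s => ∫ r in (0 : ℝ)..s, X r) (Set.Icc 0 t) := by
    have := intervalIntegral.continuousOn_primitive_interval
      (μ := volume) (f := X) (a := 0) (b := t)
      (by rw [Set.uIcc_of_le ht, integrableOn_Icc_iff_integrableOn_Ioc]
          exact (intervalIntegrable_iff_integrableOn_Ioc_of_le ht).1 hXi)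
    rwa [Set.uIcc_of_le ht] at this
  have hzi : IntervalIntegrable z volume 0 t := hz.intervalIntegrable
  have hE : ContinuousOn (fun s => Real.exp (lam * s)) (Set.uIcc 0 t) := by fun_prop
  -- Integrating factor: `exp(lam s) ∫₀ˢ X` has derivative `exp(lam s) (X + lam ∫₀ˢ X)`. Only the
  -- right derivative is available, as `X` jumps with `z`.
  have key : ∫ s in (0 : ℝ)..t, Real.exp (lam * s) * (x₀ + z s) =
      Real.exp (lam * t) * (∫ r in (0 : ℝ)..t, X r) -
        Real.exp (lam * 0) * (∫ r in (0 : ℝ)..0, X r) := by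
    refine intervalIntegral.integral_eq_sub_of_hasDeriv_right_of_le
      (f := fun s => Real.exp (lam * s) * (∫ r in (0 : ℝ)..s, X r)) ht
      (ContinuousOn.mul (by fun_prop) hYc) ?_
      ((intervalIntegrable_const.add hzi).continuousOn_mul hE)
    intro s hs
    have hs0 : (0 : ℝ) ≤ s := hs.1.le
    have hXs : IntervalIntegrable X volume 0 s := hXi.mono_set (by
      rw [Set.uIcc_of_le ht, Set.uIcc_of_le hs0]
      exact Set.Icc_subset_Icc le_rfl hs.2.le)
    have hYs : ContinuousWithinAt (fun s => ∫ r in (0 : ℝ)..s, X r) (Set.Ioi s) s := by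
      exact ((hYc s ⟨hs0, hs.2.le⟩).continuousAt (Icc_mem_nhds hs.1 hs.2)).continuousWithinAt
    have hXc : ContinuousWithinAt X (Set.Ioi s) s := by
      refine ContinuousWithinAt.congr (f := fun s => x₀ - lam * (∫ r in (0 : ℝ)..s, X r) + z s)
        ?_ (fun r hr => hX r (hs0.trans (le_of_lt hr))) (hX s hs0)
      exact (continuousWithinAt_const.sub (continuousWithinAt_const.mul hYs)).add
        ((hzc s hs0).mono Set.Ioi_subset_Ici_self)
    have hmeas : StronglyMeasurableAtFilter X (𝓝[Set.Ioi s] s) volume := by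
      refine ⟨Set.Ioc s t, Ioc_mem_nhdsGT hs.2, ?_⟩
      refine ((intervalIntegrable_iff_integrableOn_Ioc_of_le ht).1 hXi).1.mono_measure ?_
      exact Measure.restrict_mono (Set.Ioc_subset_Ioc_left hs0) le_rfl
    have hd := (intervalIntegral.integral_hasDerivWithinAt_right hXs (s := Set.Ici s) hmeas
      hXc).mono Set.Ioi_subset_Ici_self
    have he : HasDerivWithinAt (fun s => Real.exp (lam * s)) (Real.exp (lam * s) * lam)
        (Set.Ioi s) s := by
      simpa using (((hasDerivAt_id s).const_mul lam).exp).hasDerivWithinAt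
    refine (he.mul hd).congr_deriv ?_
    rw [hX s hs0]
    ring
  have hconst : ∫ s in (0 : ℝ)..t, Real.exp (lam * s) * x₀ =
      (Real.exp (lam * t) - 1) / lam * x₀ := by
    rw [intervalIntegral.integral_mul_const, intervalIntegral.integral_comp_mul_left _ hlam.ne']
    simp [div_eq_inv_mul]
  have hsplit : ∫ s in (0 : ℝ)..t, Real.exp (lam * s) * (x₀ + z s) =
      (∫ s in (0 : ℝ)..t, Real.exp (lam * s) * x₀) +
        ∫ s in (0 : ℝ)..t, Real.exp (lam * s) * z s := by
    rw [← intervalIntegral.integral_add (intervalIntegrable_const.continuousOn_mul hE)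
      (hzi.continuousOn_mul hE)]
    simp only [mul_add]
  have hW : ∫ s in (0 : ℝ)..t, Real.exp (-lam * (t - s)) * z s =
      Real.exp (-lam * t) * ∫ s in (0 : ℝ)..t, Real.exp (lam * s) * z s := by
    rw [← intervalIntegral.integral_const_mul]
    refine intervalIntegral.integral_congr fun s _ => ?_
    rw [← mul_assoc, ← Real.exp_add]
    ring_nf
  rw [hW]
  rw [hsplit, hconst] at key
  simp only [intervalIntegral.integral_same, mul_zero, sub_zero] at key
  have hexp : Real.exp (-lam * t) * Real.exp (lam * t) = 1 := by
    rw [← Real.exp_add]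
    simp
  have : ∫ s in (0 : ℝ)..t, X s = Real.exp (-lam * t) *
      (Real.exp (lam * t) * ∫ r in (0 : ℝ)..t, X r) := by rw [← mul_assoc, hexp, one_mul]
  rw [this, ← key]
  linear_combination x₀ / lam * hexp

/-- The left-endpoint Riemann–Stieltjes sum of `g` against a monotone `z`, compared with the
formula obtained from integration by parts. -/
lemma abs_stieltjes_sum_sub_le {g k z : ℝ → ℝ} {t h : ℝ} (hh : 0 ≤ h) (hz : Monotone z)
    (hk : Continuous k) (hg : ∀ s, HasDerivAt g (-k s) s) (hk1 : ∀ s ≤ t, |k s| ≤ 1)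
    (m : ℕ) (hm : m * h ≤ t) :
    |∑ j ∈ Finset.range m, g (j * h) * (z ((j + 1 : ℕ) * h) - z (j * h)) -
      (g (m * h) * z (m * h) - g 0 * z 0 + ∫ s in (0 : ℝ)..m * h, k s * z s)| ≤
      h * (z (m * h) - z 0) := by
  induction m with
  | zero => simp
  | succ m ih =>
    have hle : (m : ℝ) * h ≤ (m + 1 : ℕ) * h := by
      push_cast
      nlinarith
    have ih := ih (hle.trans hm)
    have hkz : ∀ p q, IntervalIntegrable (fun s => k s * z s) volume p q := fun p q =>
      hz.intervalIntegrable.continuousOn_mul hk.continuousOn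
    have hadd := intervalIntegral.integral_add_adjacent_intervals
      (hkz 0 (m * h)) (hkz (m * h) ((m + 1 : ℕ) * h))
    have hgi : ∫ s in (m * h : ℝ)..((m + 1 : ℕ) * h), -k s = g ((m + 1 : ℕ) * h) - g (m * h) :=
      intervalIntegral.integral_eq_sub_of_hasDerivAt (fun s _ => hg s)
        (hk.neg.intervalIntegrable _ _)
    -- This integral is, up to sign, the error of a single step. Since `|k| ≤ 1` and `z` is
    -- monotone, it is at most `h` times the increment of `z`, and these bounds telescope.
    have hsub : ∫ s in (m * h : ℝ)..((m + 1 : ℕ) * h), k s * (z ((m + 1 : ℕ) * h) - z s) =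
        (g (m * h) - g ((m + 1 : ℕ) * h)) * z ((m + 1 : ℕ) * h) -
          ∫ s in (m * h : ℝ)..((m + 1 : ℕ) * h), k s * z s := by
      rw [intervalIntegral.integral_neg] at hgi
      rw [show g (m * h) - g ((m + 1 : ℕ) * h) = ∫ s in (m * h : ℝ)..((m + 1 : ℕ) * h), k s by
        linarith, ← intervalIntegral.integral_mul_const, ← intervalIntegral.integral_sub
          ((hk.intervalIntegrable _ _).mul_const _) (hkz _ _)]
      simp only [mul_sub]
    have hbound : |∫ s in (m * h : ℝ)..((m + 1 : ℕ) * h), k s * (z ((m + 1 : ℕ) * h) - z s)| ≤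
        (z ((m + 1 : ℕ) * h) - z (m * h)) * |(m + 1 : ℕ) * h - m * h| := by
      rw [← Real.norm_eq_abs (∫ s in _.._, _)]
      refine intervalIntegral.norm_integral_le_of_norm_le_const fun s hs => ?_
      rw [Set.uIoc_of_le hle] at hs
      rw [Real.norm_eq_abs, abs_mul]
      have h1 := hk1 s (hs.2.trans hm)
      have h2 := hz hs.2
      have h3 := hz hs.1.le
      rw [abs_of_nonneg (sub_nonneg.2 h2)]
      nlinarith [abs_nonneg (k s)]
    have hw : |((m + 1 : ℕ) * h - m * h : ℝ)| = h := by
      push_cast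
      rw [show ((m : ℝ) + 1) * h - m * h = h by ring, abs_of_nonneg hh]
    rw [hw, hsub] at hbound
    rw [Finset.sum_range_succ, ← hadd]
    rw [abs_le] at *
    constructor <;> nlinarith [ih.1, ih.2, hbound.1, hbound.2]

/-- The conditions `g t = 0` and `z 0 = 0` remove the boundary terms of the integration by parts. -/
lemma tendsto_stieltjes_sum {g k z : ℝ → ℝ} {t : ℝ} (ht : 0 ≤ t) (hz : Monotone z)
    (hk : Continuous k) (hg : ∀ s, HasDerivAt g (-k s) s) (hk1 : ∀ s ≤ t, |k s| ≤ 1)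
    (hgt : g t = 0) (hz0 : z 0 = 0) :
    Filter.Tendsto (fun n : ℕ => ∑ j ∈ Finset.range n,
        g (j * (t / n)) * (z ((j + 1 : ℕ) * (t / n)) - z (j * (t / n))))
      Filter.atTop (𝓝 (∫ s in (0 : ℝ)..t, k s * z s)) := by
  rw [tendsto_iff_norm_sub_tendsto_zero]
  have hlim : Filter.Tendsto (fun n : ℕ => t / n * (z t - z 0)) Filter.atTop (𝓝 0) := by
    simpa using (tendsto_const_div_atTop_nhds_zero_nat t).mul_const (z t - z 0)
  refine squeeze_zero' (Filter.Eventually.of_forall fun _ => norm_nonneg _) ?_ hlim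
  filter_upwards [Filter.eventually_gt_atTop 0] with n hn
  have hnt : (n : ℝ) * (t / n) = t := by
    field_simp
  have := abs_stieltjes_sum_sub_le (t := t) (h := t / n) (by positivity) hz hk hg hk1 n hnt.le
  rw [hnt, hgt, hz0] at this
  rw [hz0, Real.norm_eq_abs]
  simpa using this

lemma norm_riemann_sum_sub_le {f : ℝ → ℂ} (hf : Continuous f) {t h ε : ℝ} (hh : 0 ≤ h)
    (hε : ∀ r ∈ Set.Icc 0 t, ∀ s ∈ Set.Icc 0 t, |r - s| ≤ h → ‖f r - f s‖ ≤ ε)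
    (m : ℕ) (hm : m * h ≤ t) :
    ‖∑ j ∈ Finset.range m, (h : ℂ) * f (j * h) - ∫ s in (0 : ℝ)..m * h, f s‖ ≤ m * h * ε := by
  induction m with
  | zero => simp
  | succ m ih =>
    have hle : (m : ℝ) * h ≤ (m + 1 : ℕ) * h := by
      push_cast
      nlinarith
    have hm0 : (0 : ℝ) ≤ m * h := by positivity
    have ih := ih (hle.trans hm)
    have hw : ((m + 1 : ℕ) * h - m * h : ℝ) = h := by
      push_cast
      ring
    have hbound : ‖∫ s in (m * h : ℝ)..((m + 1 : ℕ) * h), (f (m * h) - f s)‖ ≤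
        ε * |(m + 1 : ℕ) * h - m * h| := by
      refine intervalIntegral.norm_integral_le_of_norm_le_const fun s hs => ?_
      rw [Set.uIoc_of_le hle] at hs
      refine hε _ ⟨hm0, hle.trans hm⟩ _ ⟨hm0.trans hs.1.le, hs.2.trans hm⟩ ?_
      rw [abs_le]
      constructor <;> linarith [hs.1, hs.2]
    rw [intervalIntegral.integral_sub intervalIntegrable_const (hf.intervalIntegrable _ _),
      intervalIntegral.integral_const, hw, abs_of_nonneg hh, Complex.real_smul] at hbound
    rw [Finset.sum_range_succ, ← intervalIntegral.integral_add_adjacent_intervals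
      (hf.intervalIntegrable 0 (m * h)) (hf.intervalIntegrable (m * h) ((m + 1 : ℕ) * h))]
    calc _ = ‖(∑ j ∈ Finset.range m, (h : ℂ) * f (j * h) - ∫ s in (0 : ℝ)..m * h, f s) +
          ((h : ℂ) * f (m * h) - ∫ s in (m * h : ℝ)..((m + 1 : ℕ) * h), f s)‖ := by
            congr 1
            ring
      _ ≤ _ := norm_add_le _ _
      _ ≤ m * h * ε + ε * h := add_le_add ih hbound
      _ = _ := by push_cast; ring

lemma tendsto_riemann_sum {f : ℝ → ℂ} (hf : Continuous f) {t : ℝ} (ht : 0 ≤ t) :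
    Filter.Tendsto (fun n : ℕ => ∑ j ∈ Finset.range n, ((t / n : ℝ) : ℂ) * f (j * (t / n)))
      Filter.atTop (𝓝 (∫ s in (0 : ℝ)..t, f s)) := by
  have huc := (isCompact_Icc (a := (0 : ℝ)) (b := t)).uniformContinuousOn_of_continuous
    hf.continuousOn
  rw [Metric.uniformContinuousOn_iff] at huc
  rw [Metric.tendsto_atTop']
  intro ε hε
  -- The denominator `t + 1` covers `t = 0` and makes `t ε / (t + 1) < ε` strict.
  obtain ⟨δ, hδ, hd⟩ := huc (ε / (t + 1)) (by positivity)
  have hsmall := (tendsto_const_div_atTop_nhds_zero_nat t).eventually (gt_mem_nhds hδ)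
  obtain ⟨N, hN⟩ := Filter.eventually_atTop.1 hsmall
  refine ⟨N, fun n hn => ?_⟩
  have hn0 : (n : ℝ) ≠ 0 := by
    have : 0 < n := by omega
    positivity
  have hnt : (n : ℝ) * (t / n) = t := by
    field_simp
  have := norm_riemann_sum_sub_le hf (t := t) (h := t / n) (ε := ε / (t + 1)) (by positivity)
    (fun r hr s hs hrs => by
      have := hd r hr s hs (by rw [Real.dist_eq]; exact hrs.trans_lt (hN n hn.le))
      rw [dist_eq_norm] at this
      exact this.le) n hnt.le
  rw [hnt] at this
  rw [dist_eq_norm]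
  refine this.trans_lt ?_
  rw [mul_div_assoc', div_lt_iff₀ (by positivity)]
  nlinarith

end Path

/-! ### Characteristic functions of weighted sums of Lévy increments. -/

section CharFun

variable {Ω : Type*} [MeasurableSpace Ω] {P : Measure Ω} {Z : ℝ≥0 → Ω → ℝ} {Ψ : ℝ → ℂ}

lemma IsLevyProcess.charFun_increment (hZ : IsLevyProcess P Z) (hΨ : HasCharExponent P Z Ψ)
    {s t : ℝ≥0} (hst : s ≤ t) (u : ℝ) :
    charFun (P.map fun ω => Z t ω - Z s ω) u = Complex.exp (((t - s : ℝ≥0) : ℂ) * Ψ u) := by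
  have h := (hZ.stationary_increments s (t - s)).map_eq
  rw [add_tsub_cancel_of_le hst] at h
  rw [h, hΨ]

lemma charFun_map_const_mul {Y : Ω → ℝ} (hY : Measurable Y) (c u : ℝ) :
    charFun (P.map fun ω => c * Y ω) u = charFun (P.map Y) (u * c) := by
  simp only [charFun_apply_real]
  rw [integral_map (by fun_prop) (by fun_prop), integral_map (by fun_prop) (by fun_prop)]
  push_cast
  simp only [mul_assoc]

/-- Characteristic function of a weighted sum of increments of a Lévy process. -/
lemma IsLevyProcess.charFun_weighted_sum (hZ : IsLevyProcess P Z) (hΨ : HasCharExponent P Z Ψ)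
    {τ : ℕ → ℝ≥0} (hτ : Monotone τ) (c : ℕ → ℝ) (n : ℕ) (u : ℝ) :
    charFun (P.map fun ω => ∑ j ∈ Finset.range n, c j * (Z (τ (j + 1)) ω - Z (τ j) ω)) u =
      Complex.exp (∑ j ∈ Finset.range n,
        ((τ (j + 1) - τ j : ℝ≥0) : ℂ) * Ψ (u * c j)) := by
  have hm : ∀ j, Measurable fun ω => Z (τ (j + 1)) ω - Z (τ j) ω := fun j =>
    (hZ.measurable _).sub (hZ.measurable _)
  have hind : iIndepFun (fun j ω => c j * (Z (τ (j + 1)) ω - Z (τ j) ω)) P :=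
    (hZ.indep_increments.nat hτ).comp (fun j y => c j * y) (fun j => by fun_prop)
  rw [iIndepFun.charFun_map_fun_finsetSum_eq_prod
    (X := fun j ω => c j * (Z (τ (j + 1)) ω - Z (τ j) ω))
    (fun j _ => ((hm j).const_mul _).aemeasurable) (hind.restrict _), Finset.prod_apply,
    Complex.exp_sum]
  refine Finset.prod_congr rfl fun j _ => ?_
  rw [charFun_map_const_mul (hm j), hZ.charFun_increment hΨ (hτ j.le_succ)]

end CharFun


/-! ### Integrated Ornstein–Uhlenbeck processes and the trace. -/

noncomputable section

/-- Left-endpoint sum with `n` steps for `∫_0^t (1 - exp(-lam (t - s))) / lam dz(lam s)`. -/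
def ouSum (lam t : ℝ) (n : ℕ) (z : ℝ≥0 → ℝ) : ℝ :=
  ∑ j ∈ Finset.range n, (1 - Real.exp (-lam * (t - j * (t / n)))) / lam *
    (z (lam * ((j + 1 : ℕ) * (t / n))).toNNReal - z (lam * (j * (t / n))).toNNReal)

end

/-- The sum reads finitely many coordinates, so it is measurable for the product σ-algebra on paths,
in which independence of the drivers is stated. -/
lemma measurable_ouSum (lam t : ℝ) (n : ℕ) : Measurable (ouSum lam t n) := by
  unfold ouSum
  fun_prop

lemma monotone_comp_toNNReal {lam : ℝ} (hlam : 0 < lam) {z : ℝ≥0 → ℝ} (hz : Monotone z) :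
    Monotone fun s : ℝ => z (lam * s).toNNReal := fun _ _ h =>
  hz (Real.toNNReal_le_toNNReal (mul_le_mul_of_nonneg_left h hlam.le))

lemma tendsto_ouSum {lam t : ℝ} (hlam : 0 < lam) (ht : 0 ≤ t) {z : ℝ≥0 → ℝ} (hz : Monotone z)
    (hz0 : z 0 = 0) :
    Filter.Tendsto (fun n => ouSum lam t n z) Filter.atTop
      (𝓝 (∫ s in (0 : ℝ)..t, Real.exp (-lam * (t - s)) * z (lam * s).toNNReal)) := by
  have hg : ∀ s, HasDerivAt (fun s => (1 - Real.exp (-lam * (t - s))) / lam)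
      (-Real.exp (-lam * (t - s))) s := fun s => by
    have h := ((((((hasDerivAt_id s).const_sub t).const_mul (-lam)).exp).const_sub 1).div_const lam)
    refine h.congr_deriv ?_
    simp only [id]
    field_simp
  refine tendsto_stieltjes_sum (g := fun s => (1 - Real.exp (-lam * (t - s))) / lam)
    (k := fun s => Real.exp (-lam * (t - s))) ht (monotone_comp_toNNReal hlam hz)
    (by fun_prop) hg (fun s hs => ?_) (by simp) (by simpa using hz0)
  rw [Real.abs_exp, Real.exp_le_one_iff]
  nlinarith

lemma loading_eq (A θ : Matrix (Fin 2) (Fin 2) ℝ) (l : Fin 2) :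
    loading A θ l = ∑ j, ∑ k, θ j k * (A k l * A j l) := by
  fin_cases l <;>
  simp [loading, Matrix.trace, Matrix.mul_apply, Fin.sum_univ_two, Matrix.single_apply] <;> ring

lemma trace_integratedCovariance {Ω : Type*} (A θ : Matrix (Fin 2) (Fin 2) ℝ) {F V : Fin 2 → ℝ≥0 → Ω → ℝ}
    {t : ℝ≥0} {ω : Ω}
    (hF : ∀ l, IntervalIntegrable (fun s : ℝ => F l s.toNNReal ω) volume 0 t)
    (hV : ∀ l, IntervalIntegrable (fun s : ℝ => V l s.toNNReal ω) volume 0 t) :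
    Matrix.trace (θ * integratedCovariance A F V t ω) =
      ∑ l, θ l l * (∫ s in (0 : ℝ)..t, F l s.toNNReal ω) +
        ∑ l, loading A θ l * ∫ s in (0 : ℝ)..t, V l s.toNNReal ω := by
  have hentry : ∀ j k, integratedCovariance A F V t ω j k =
      (if j = k then ∫ s in (0 : ℝ)..t, F j s.toNNReal ω else 0) +
        ∑ l, A j l * A k l * ∫ s in (0 : ℝ)..t, V l s.toNNReal ω := fun j k => by
    have hcov : ∀ s : ℝ, covariance A F V s.toNNReal ω j k =
        (if j = k then F j s.toNNReal ω else 0) + ∑ l, A j l * A k l * V l s.toNNReal ω :=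
      fun s => by
        simp only [covariance, Matrix.add_apply, Matrix.diagonal_apply]
        rw [Matrix.mul_apply]
        simp only [Matrix.mul_diagonal, Matrix.transpose_apply]
        congr 1
        exact Finset.sum_congr rfl fun l _ => by ring
    simp only [integratedCovariance, Matrix.of_apply, hcov]
    rw [intervalIntegral.integral_add, intervalIntegral.integral_finsetSum]
    · simp only [intervalIntegral.integral_const_mul]
      split_ifs <;> simp
    · exact fun l _ => (hV l).const_mul _
    · split_ifs
      · exact hF j
      · exact intervalIntegrable_const
    · simp only [Fin.sum_univ_two]
      exact ((hV 0).const_mul _).add ((hV 1).const_mul _)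
  simp only [Matrix.trace, Matrix.diag, Matrix.mul_apply, hentry, loading_eq, Fin.sum_univ_two]
  simp
  ring

variable {Ω : Type*} [MeasurableSpace Ω] {P : Measure Ω} {Z X : ℝ≥0 → Ω → ℝ}
  {lam a b x₀ : ℝ}

lemma IsIGSubordinator.tendsto_charFun_ouSum (hZ : IsIGSubordinator P a b Z) (hlam : 0 < lam)
    (hb : 0 < b) (t : ℝ≥0) (x : ℝ) :
    Filter.Tendsto (fun n => charFun (P.map fun ω => ouSum lam t n (Z · ω)) x) Filter.atTop
      (𝓝 (Complex.exp (intExponent lam a b t x))) := by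
  have ht := t.coe_nonneg
  have hlim := tendsto_riemann_sum (f := fun s => lam * igExponent a b
      (x * ((1 - Real.exp (-lam * (t - s))) / lam)))
    (continuous_const.mul (continuous_igExponent_comp hb (by fun_prop))) ht
  -- Time reversal `s ↦ t - s` matches the kernel to `integral_igExponent`.
  have hint : ∫ s in (0 : ℝ)..t, lam * igExponent a b
      (x * ((1 - Real.exp (-lam * (t - s))) / lam)) = intExponent lam a b t x := by
    rw [← integral_igExponent hlam hb]
    have := intervalIntegral.integral_comp_sub_left (a := 0) (b := t) (fun u : ℝ =>
      lam * igExponent a b (x * ((1 - Real.exp (-lam * u)) / lam))) (t : ℝ)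
    simpa only [sub_self, sub_zero] using this
  change Filter.Tendsto _ _ (𝓝 (∫ s in (0 : ℝ)..t, _)) at hlim
  rw [hint] at hlim
  refine ((Complex.continuous_exp.tendsto _).comp hlim).congr fun n => ?_
  have hτ : Monotone fun j : ℕ => (lam * (j * ((t : ℝ) / n))).toNNReal := fun i j hij => by
    apply Real.toNNReal_le_toNNReal
    have : (i : ℝ) ≤ j := by exact_mod_cast hij
    gcongr
  have h := hZ.toIsLevyProcess.charFun_weighted_sum hZ.charExponent hτ
    (fun j => (1 - Real.exp (-lam * (t - j * (t / n)))) / lam) n x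
  simp only [ouSum]
  rw [h]
  simp only [Function.comp_apply]
  congr 1
  refine Finset.sum_congr rfl fun j _ => ?_
  -- The clock `lam s` gives each increment length `lam t / n`, the source of the factor `lam` in
  -- the Riemann sum.
  have hinc : ((((lam * ((j + 1 : ℕ) * ((t : ℝ) / n))).toNNReal -
      (lam * (j * ((t : ℝ) / n))).toNNReal : ℝ≥0)) : ℝ) = lam * (t / n) := by
    rw [NNReal.coe_sub (hτ j.le_succ), Real.coe_toNNReal _ (by positivity),
      Real.coe_toNNReal _ (by positivity)]
    push_cast
    ring
  rw [hinc]
  generalize igExponent _ _ _ = w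
  push_cast
  ring

/-- The integrated Ornstein–Uhlenbeck path as an almost sure limit of measurable functionals of the
driving subordinator. -/
lemma IsOUProcess.tendsto_ouSum (hX : IsOUProcess P lam x₀ Z X) (hZ : IsIGSubordinator P a b Z)
    (hlam : 0 < lam) (t : ℝ≥0) :
    ∀ᵐ ω ∂P, Filter.Tendsto (fun n => ouSum lam t n (Z · ω)) Filter.atTop
      (𝓝 ((∫ s in (0 : ℝ)..t, X s.toNNReal ω) -
        x₀ * ((1 - Real.exp (-lam * t)) / lam))) := by
  filter_upwards [hX, hZ.monotone_paths, hZ.start_zero, hZ.cadlag] with ω hω hmono h0 hc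
  have hzc : ∀ s : ℝ, 0 ≤ s →
      ContinuousWithinAt (fun s : ℝ => Z (lam * s).toNNReal ω) (Set.Ici s) s := fun s hs => by
    refine ContinuousWithinAt.comp (g := fun r => Z r ω) (f := fun s : ℝ => (lam * s).toNNReal)
      (t := Set.Ici (lam * s).toNNReal) (hc _).1 ?_ fun r hr => ?_
    · exact (continuous_real_toNNReal.comp (continuous_const_mul lam)).continuousWithinAt
    · exact Real.toNNReal_le_toNNReal (mul_le_mul_of_nonneg_left hr hlam.le)
  have hXeq : ∀ s : ℝ, 0 ≤ s → X s.toNNReal ω =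
      x₀ - lam * (∫ r in (0 : ℝ)..s, X r.toNNReal ω) + Z (lam * s).toNNReal ω := fun s hs => by
    simpa [Real.coe_toNNReal s hs] using (hω s.toNNReal).2
  rw [integral_eq_of_ou_equation hlam t.coe_nonneg (monotone_comp_toNNReal hlam hmono) hzc (hω t).1 hXeq,
    add_sub_cancel_left]
  exact OUCovariance.tendsto_ouSum hlam t.2 hmono h0

/-- Joint characteristic function of integrated Ornstein–Uhlenbeck processes driven by independent
inverse Gaussian subordinators. -/
lemma integral_exp_sum_integrated_ou {ι : Type*} [Fintype ι] [IsProbabilityMeasure P]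
    {Z X : ι → ℝ≥0 → Ω → ℝ} {lam a b x₀ : ι → ℝ} (hlam : ∀ j, 0 < lam j) (hb : ∀ j, 0 < b j)
    (hZ : ∀ j, IsIGSubordinator P (a j) (b j) (Z j))
    (hX : ∀ j, IsOUProcess P (lam j) (x₀ j) (Z j) (X j))
    (hind : iIndepFun (fun j ω (t : ℝ≥0) => Z j t ω) P) (t : ℝ≥0) (c : ι → ℝ) :
    ∫ ω, Complex.exp (Complex.I *
        ((∑ j, c j * ∫ s in (0 : ℝ)..t, X j s.toNNReal ω : ℝ) : ℂ)) ∂P =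
      Complex.exp (∑ j, (Complex.I * (c j * (lam j : ℂ)⁻¹ *
        (1 - Complex.exp (-(lam j : ℂ) * (t : ℂ))) * x₀ j) +
          intExponent (lam j) (a j) (b j) t (c j))) := by
  set d : ι → ℝ := fun j => x₀ j * ((1 - Real.exp (-lam j * t)) / lam j) with hd
  have hmZ : ∀ j, Measurable fun ω (t : ℝ≥0) => Z j t ω := fun j =>
    measurable_pi_lambda _ (hZ j).measurable
  have hmS : ∀ j n, Measurable fun ω => ouSum (lam j) t n (Z j · ω) := fun j n =>
    (measurable_ouSum (lam j) t n).comp (hmZ j)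
  set f : ℕ → Ω → ℂ := fun n ω =>
    ∏ j, Complex.exp (c j * (ouSum (lam j) t n (Z j · ω) : ℝ) * Complex.I) with hf
  have hprod : ∀ n, ∫ ω, f n ω ∂P =
      ∏ j, charFun (P.map fun ω => ouSum (lam j) t n (Z j · ω)) (c j) := fun n => by
    rw [hf, hind.integral_fun_prod_comp (f := fun j z =>
      Complex.exp (c j * (ouSum (lam j) t n z : ℝ) * Complex.I))
      (fun j => (hmZ j).aemeasurable) fun j => ?_]
    · refine Finset.prod_congr rfl fun j _ => ?_
      rw [charFun_apply_real, integral_map (hmS j n).aemeasurable (by fun_prop)]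
    · have := measurable_ouSum (lam j) t n
      exact Measurable.aestronglyMeasurable (by fun_prop)
  have hlim1 : Filter.Tendsto (fun n => ∫ ω, f n ω ∂P) Filter.atTop
      (𝓝 (∏ j, Complex.exp (intExponent (lam j) (a j) (b j) t (c j)))) := by
    simp only [hprod]
    exact tendsto_finsetProd _ fun j _ => (hZ j).tendsto_charFun_ouSum (hlam j) (hb j) t (c j)
  -- The integrands have modulus one and converge almost surely, so the constant `1` dominates. No
  -- measurability of `X` is needed, only of the approximating sums.
  have hlim2 : Filter.Tendsto (fun n => ∫ ω, f n ω ∂P) Filter.atTop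
      (𝓝 (∫ ω, ∏ j, Complex.exp (c j *
        (((∫ s in (0 : ℝ)..t, X j s.toNNReal ω) - d j : ℝ) : ℂ) * Complex.I) ∂P)) := by
    refine tendsto_integral_of_dominated_convergence (fun _ => 1) (fun n => ?_)
      (integrable_const _) (fun n => ?_) ?_
    · exact Measurable.aestronglyMeasurable (by have := fun j => hmS j n; fun_prop)
    · refine Filter.Eventually.of_forall fun ω => ?_
      simp only [hf, norm_prod, ← Complex.ofReal_mul, Complex.norm_exp_ofReal_mul_I,
        Finset.prod_const_one, le_refl]
    · filter_upwards [ae_all_iff.2 fun j => (hX j).tendsto_ouSum (hZ j) (hlam j) t] with ω hω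
      refine tendsto_finsetProd _ fun j _ => ?_
      have hcont : Continuous fun y : ℝ => Complex.exp (c j * (y : ℂ) * Complex.I) := by fun_prop
      exact (hcont.tendsto _).comp (hω j)
  have heq := tendsto_nhds_unique hlim2 hlim1
  calc _ = ∫ ω, Complex.exp (∑ j, Complex.I * (c j * d j)) * ∏ j, Complex.exp (c j *
        (((∫ s in (0 : ℝ)..t, X j s.toNNReal ω) - d j : ℝ) : ℂ) * Complex.I) ∂P := by
        congr 1
        funext ω
        rw [← Complex.exp_sum, ← Complex.exp_add, ← Finset.sum_add_distrib]
        push_cast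
        rw [Finset.mul_sum]
        congr 1
        refine Finset.sum_congr rfl fun j _ => ?_
        ring
    _ = _ := by
        rw [integral_const_mul, heq, ← Complex.exp_sum, ← Complex.exp_add,
          ← Finset.sum_add_distrib]
        congr 1
        refine Finset.sum_congr rfl fun j _ => ?_
        simp only [hd]
        push_cast
        ring

end OUCovariance

theorem theorem3p1 {Ω : Type*} [MeasurableSpace Ω] (Q : Measure Ω) [IsProbabilityMeasure Q]
    (A : Matrix (Fin 2) (Fin 2) ℝ) (hA : A ∈ Matrix.orthogonalGroup (Fin 2) ℝ)
    (lamF aF bF F₀ lamV aV bV V₀ : Fin 2 → ℝ)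
    (hlamF : ∀ l, 0 < lamF l) (haF : ∀ l, 0 < aF l) (hbF : ∀ l, 0 < bF l)
    (hlamV : ∀ l, 0 < lamV l) (haV : ∀ l, 0 < aV l) (hbV : ∀ l, 0 < bV l)
    (ZF ZV F V : Fin 2 → ℝ≥0 → Ω → ℝ)
    (hZF : ∀ l, OUCovariance.IsIGSubordinator Q (aF l) (bF l) (ZF l))
    (hZV : ∀ l, OUCovariance.IsIGSubordinator Q (aV l) (bV l) (ZV l))
    (hindep : iIndepFun (fun (j : Fin 2 ⊕ Fin 2) (ω : Ω) (t : ℝ≥0) => Sum.elim ZF ZV j t ω) Q)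
    (hF : ∀ l, OUCovariance.IsOUProcess Q (lamF l) (F₀ l) (ZF l) (F l))
    (hV : ∀ l, OUCovariance.IsOUProcess Q (lamV l) (V₀ l) (ZV l) (V l))
    (t : ℝ≥0) (θ : Matrix (Fin 2) (Fin 2) ℝ) :
    OUCovariance.matrixCharFun Q (OUCovariance.integratedCovariance A F V t) θ =
      Complex.exp (OUCovariance.K₁ lamF aF bF F₀ t θ + OUCovariance.K₂ A lamV aV bV V₀ t θ) := by
  -- All four factors are treated as one independent family over `Fin 2 ⊕ Fin 2`, with their
  -- coefficients in the trace as weights.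
  have h := OUCovariance.integral_exp_sum_integrated_ou (P := Q) (Z := Sum.elim ZF ZV)
    (X := Sum.elim F V) (lam := Sum.elim lamF lamV) (a := Sum.elim aF aV) (b := Sum.elim bF bV)
    (x₀ := Sum.elim F₀ V₀) (Sum.rec hlamF hlamV) (Sum.rec hbF hbV) (Sum.rec hZF hZV)
    (Sum.rec hF hV) hindep t (Sum.elim (fun l => θ l l) (OUCovariance.loading A θ))
  simp only [Fintype.sum_sum_type, Sum.elim_inl, Sum.elim_inr] at h
  rw [OUCovariance.K₁, OUCovariance.K₂, Finset.mul_sum, Finset.mul_sum, ← Finset.sum_add_distrib,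
    ← Finset.sum_add_distrib, ← h, OUCovariance.matrixCharFun]
  refine integral_congr_ae ?_
  filter_upwards [ae_all_iff.2 hF, ae_all_iff.2 hV] with ω hFω hVω
  rw [OUCovariance.trace_integratedCovariance A θ (fun l => (hFω l t).1) (fun l => (hVω l t).1)]
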